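/- Fix an integer $\mathfrak m\ge 2$. For a finite graph $A$ put $\delta(A)=\mathfrak m|A|-|\mathcal R(A)|$, where $\mathcal R(A)$ is the set of edges of $A$. For finite graphs $A\subseteq B$ (induced subgraphs) write $A\leqslant B$ if $\delta(A')\ge\delta(A)$ for all $A\subseteq A'\subseteq B$; for a finite subset $A$ of an arbitrary graph $N$ write $A\leqslant N$ (and say that $A$ is $\leqslant$-closed in $N$) if $A\leqslant B$ for every finite $B$ with $A\subseteq B\subseteq N$. Let $\mathsf K_0$ be the class of finite graphs $A$ with $\delta(A')\ge 0$ for all $A'\subseteq A$. Let $\mathbf M$ be the $(\mathsf K_0,\leqslant)$-generic structure, that is, the (unique up to isomorphism) countable graph such that $\mathbf M$ is the union of a chain of finite $\leqslant$-closed sets, every isomorphism between finite $\leqslant$-closed subsets of $\mathbf M$ extends to an automorphism of $\mathbf M$, and every element of $\mathsf K_0$ is isomorphic to a $\leqslant$-closed subset of $\mathbf M$. For finite $A\subseteq\mathbf M$ let $\mathrm{cl}(A)$ be the smallest finite $\leqslant$-closed subset of $\mathbf M$ containing $A$, and put $\mathrm d(A)=\delta(\mathrm{cl}(A))$. For $X\subseteq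 \mathbf M$ let $\mathrm{gcl}(X)$ be the set of all $v\in\mathbf M$ such that $\mathrm d(A\cup\{v\})-\mathrm d(A)=0$ for some finite $A\subseteq X$. Let $\hat{\mathbf M}=\mathrm{gcl}(\emptyset)$, considered as an induced subgraph of $\mathbf M$ and as a first-order structure in the language of graphs. For a countable first-order structure $M$ with automorphism group $G=\mathrm{Aut}(M)$ (with the topology of pointwise convergence) and a substructure $A$, let $G_A$ be the pointwise stabilizer of $A$ in $G$. A countable class $\mathscr B$ of substructures of $M$ is a base for $M$ if $G_A$ is open in $G$ for all $A\in\mathscr B$, and $g[A]\in\mathscr B$ for all $A\in\mathscr B$ and $g\in G$. A base $\mathscr B$ is an amalgamation base for $M$ if (a) $\mathscr B$ is countable; (b) if $e_1,\dots,e_n$ are finite (partial) elementary maps from $M$ to $M$ and $A\in\mathscr B$, then there are $B\in\mathscr B$ containing $A$ and $f_i\in\mathrm{Aut}(B)$ such that $f_i$ extends $e_i$ for all $1\le i\le n$; (c) if $A,B,C\in\mathscr B$ with $A\subseteq B$ and $A\subseteq C$, then there is $\alpha\in G_A$ such that whenever $g\in\mathrm{Aut}(\alpha[B])$ and $h\in\mathrm{Aut}(C)$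 satisfy $g\restriction A=h\restriction A\in\mathrm{Aut}(A)$, then $g\cup h$ is an elementary map that can be extended to an automorphism of $M$. Corollary. The class $\mathscr C=\{A\subseteq\hat{\mathbf M}: A \text{ finite},\ \delta(A)=0\}$ is an amalgamation base for $\hat{\mathbf M}$. -/

import Mathlib

open FirstOrder

/-! ## Amalgamation bases of a first-order structure -/

namespace ModelBase

variable {L : FirstOrder.Language} {M : Type*} [L.Structure M]

/-- A map defined on a subset `D` of `M` is elementary if it preserves the truth value in `M` of all
first-order formulas (the variables of a formula `φ : L.Formula D` are indexed by `D`). -/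
def IsElementaryMap (L : FirstOrder.Language) {M : Type*} [L.Structure M] {D : Set M}
    (e : D → M) : Prop :=
  ∀ φ : L.Formula D, φ.Realize (fun x : D => (x : M)) ↔ φ.Realize e

/-- The partial map `f` with domain `D'` extends the partial map `e` with domain `D`. -/
def Extends {M : Type*} {D D' : Set M} (f : D' → M) (e : D → M) : Prop :=
  ∃ h : D ⊆ D', ∀ x : D, f ⟨x.1, h x.2⟩ = e x

/-- An automorphism of a substructure `B` of `M`, seen as a partial map of `M` with domain `B`. -/
def autMap {B : L.Substructure M} (f : B ≃[L] B) : ↥(B : Set M) → M :=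
  fun x => (f ⟨x.1, x.2⟩ : M)

/-- The topology of pointwise convergence on the automorphism group of `M`: the topology induced by
the product topology on `M → M`, where `M` is discrete. -/
abbrev autTopology (L : FirstOrder.Language) (M : Type*) [L.Structure M] :
    TopologicalSpace (M ≃[L] M) :=
  TopologicalSpace.induced (fun g : M ≃[L] M => (g : M → M))
    (@Pi.topologicalSpace M (fun _ => M) (fun _ => ⊥))

/-- The (underlying set of the) pointwise stabilizer of `A` in the automorphism group of `M`. -/
def pointwiseStabilizer (A : L.Substructure M) : Set (M ≃[L] M) :=
  {g | ∀ x ∈ A, g x = x}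

/-- A base for `M`: a countable class of substructures of `M`, invariant under automorphisms, whose
members have open pointwise stabilizers. -/
structure IsBase (𝓑 : Set (L.Substructure M)) : Prop where
  countable : 𝓑.Countable
  isOpen : ∀ A ∈ 𝓑, @IsOpen (M ≃[L] M) (autTopology L M) (pointwiseStabilizer A)
  map_mem : ∀ A ∈ 𝓑, ∀ g : M ≃[L] M, A.map g.toHom ∈ 𝓑

/-- An amalgamation base for `M`: a (countable) base such that
* for all finite elementary maps `e₁, …, eₙ` from `M` to `M` and all `A ∈ 𝓑` there is `B ∈ 𝓑`
  containing `A` with automorphisms `f₁, …, fₙ` of `B` extending `e₁, …, eₙ`;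
* for all `A, B, C ∈ 𝓑` with `A ⊆ B` and `A ⊆ C` there is `α ∈ Aut(M)` fixing `A` pointwise such that
  whenever `g ∈ Aut(α[B])` and `h ∈ Aut(C)` both restrict to the same `k ∈ Aut(A)`, then `g ∪ h` is
  an elementary map which can be extended to an automorphism of `M`. -/
structure IsAmalgamationBase (𝓑 : Set (L.Substructure M)) : Prop extends IsBase 𝓑 where
  exists_extension : ∀ (n : ℕ) (D : Fin n → Set M) (e : ∀ i, D i → M),
    (∀ i, (D i).Finite) → (∀ i, IsElementaryMap L (e i)) →
    ∀ A ∈ 𝓑, ∃ B ∈ 𝓑, A ≤ B ∧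
      ∃ f : Fin n → (B ≃[L] B), ∀ i, Extends (autMap (f i)) (e i)
  exists_amalgam : ∀ A ∈ 𝓑, ∀ B ∈ 𝓑, ∀ C ∈ 𝓑, A ≤ B → A ≤ C →
    ∃ α ∈ pointwiseStabilizer A,
      ∀ (g : B.map α.toHom ≃[L] B.map α.toHom) (h : C ≃[L] C),
        (∃ k : A ≃[L] A, Extends (autMap g) (autMap k) ∧ Extends (autMap h) (autMap k)) →
        ∃ u : ↥(((B.map α.toHom : L.Substructure M) : Set M) ∪ (C : Set M)) → M,
          Extends u (autMap g) ∧ Extends u (autMap h) ∧ IsElementaryMap L u ∧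
            ∃ σ : M ≃[L] M, ∀ x, σ x.1 = u x

end ModelBase

/-! ## The ab-initio generic graph -/

namespace AbInitio

/-- The predimension `δ(A) = m · |A| - |R(A)|` of a finite graph (only used for finite graphs). -/
noncomputable def graphDelta (m : ℕ) {W : Type*} (H : SimpleGraph W) : ℤ :=
  (m : ℤ) * (Nat.card W : ℤ) - (H.edgeSet.ncard : ℤ)

variable {V : Type*}

/-- The predimension of the subgraph induced on a (finite) set of vertices. -/
noncomputable def delta (m : ℕ) (G : SimpleGraph V) (A : Set V) : ℤ :=
  graphDelta m (G.induce A)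

/-- The class `K₀` of finite graphs all of whose subgraphs have nonnegative predimension. -/
def InK0 (m : ℕ) {W : Type*} (H : SimpleGraph W) : Prop :=
  Finite W ∧ ∀ A : Set W, 0 ≤ delta m H A

/-- `A ⩽ B` for finite sets of vertices `A`, `B` of a graph. -/
def IsClosedIn (m : ℕ) (G : SimpleGraph V) (A B : Set V) : Prop :=
  A ⊆ B ∧ ∀ A' : Set V, A ⊆ A' → A' ⊆ B → delta m G A ≤ delta m G A'

/-- `A` is a finite `⩽`-closed subset of the whole graph: `A ⩽ B` for every finite `B ⊇ A`. -/
def IsClosedSet (m : ℕ) (G : SimpleGraph V) (A : Set V) : Prop :=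
  A.Finite ∧ ∀ B : Set V, B.Finite → A ⊆ B → IsClosedIn m G A B

/-- `G` is the `(K₀, ⩽)`-generic structure: the countable graph, unique up to isomorphism, with the
following three properties. (The last one, applied to the graph without vertices, says that `∅` is
`⩽`-closed in `G`, that is, that all finite subgraphs of `G` are in `K₀`.) -/
structure IsGeneric (m : ℕ) (G : SimpleGraph V) : Prop where
  countable : Countable V
  exists_chain : ∃ s : ℕ → Set V, Monotone s ∧ (∀ i, IsClosedSet m G (s i)) ∧ ⋃ i, s i = Set.univ
  homogeneous : ∀ A B : Set V, IsClosedSet m G A → IsClosedSet m G B →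
    ∀ e : G.induce A ≃g G.induce B, ∃ σ : G ≃g G, ∀ x : A, σ x = e x
  universal : ∀ (W : Type) (H : SimpleGraph W), InK0 m H →
    ∃ f : H ↪g G, IsClosedSet m G (Set.range f)

/-- `cl(A)`: the smallest finite `⩽`-closed set containing `A`, as the intersection of all of them
(in the generic structure, for finite `A`, this intersection is itself finite and `⩽`-closed). -/
def cl (m : ℕ) (G : SimpleGraph V) (A : Set V) : Set V :=
  ⋂₀ {C | A ⊆ C ∧ IsClosedSet m G C}

/-- The dimension `d(A) = δ(cl(A))` of a finite set. -/
noncomputable def dim (m : ℕ) (G : SimpleGraph V) (A : Set V) : ℤ :=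
  delta m G (cl m G A)

/-- The geometric closure: `gcl(X)` is the set of all `v` with `d(v/A) = d(A ∪ {v}) - d(A) = 0` for
some finite `A ⊆ X`. -/
def gcl (m : ℕ) (G : SimpleGraph V) (X : Set V) : Set V :=
  {v | ∃ A : Set V, A.Finite ∧ A ⊆ X ∧ dim m G (insert v A) - dim m G A = 0}

/-- The underlying set of `M̂ = gcl(∅)`. -/
def Hat (m : ℕ) (G : SimpleGraph V) : Type _ := ↥(gcl m G ∅)

/-- The graph `M̂ = gcl(∅)`, as an induced subgraph of `G`. -/
def hatGraph (m : ℕ) (G : SimpleGraph V) : SimpleGraph (Hat m G) :=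
  G.induce (gcl m G ∅)

/-- `M̂` as a first-order structure in the language of graphs. -/
instance hatStructure (m : ℕ) (G : SimpleGraph V) : Language.graph.Structure (Hat m G) :=
  (hatGraph m G).structure

/-- The class of all finite `A ⊆ M̂` with `δ(A) = 0`. Since the language of graphs is relational,
every subset of `M̂` is the underlying set of a substructure. -/
def zeroSets (m : ℕ) (G : SimpleGraph V) : Set (Language.graph.Substructure (Hat m G)) :=
  {A | (A : Set (Hat m G)).Finite ∧ delta m (hatGraph m G) (A : Set (Hat m G)) = 0}

end AbInitio

/-! Call a finite set zero if its predimension is `0`. In a graph all of whose finite subsets have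
nonnegative predimension, submodularity of `δ` makes unions and intersections of zero sets zero, and
equality in the submodular law forbids edges between the two parts outside the intersection
(`IsZero.union`, `IsZero.inter`, `IsZero.no_cross`). So two zero sets are always in free position
over their intersection, provided it is known, and free amalgamation over a zero set keeps
predimensions nonnegative (`Sparse.union`).

By `mem_gcl_empty_iff`, the elements of `gcl(∅)` are those lying in a zero set. Zero sets are
`⩽`-closed, so `gcl(∅)` inherits homogeneity and universality for zero sets (`ZeroGeneric`).

Condition (b) rests on an extension property for partial isomorphisms
(`exists_extending_partial_isomorphisms`). All sparse zero graphs on a fixed finite vertex set `W`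
are glued along the zero sets where they agree. The result is again sparse and zero, and every
permutation of `W` acts on it, because permutations permute the graphs being glued. An isomorphism
between zero subsets of one copy extends to a permutation of `W`; this permutation moves the copy to
another one that is glued to it along the image, so its action extends the given isomorphism.

For condition (c), `α` moves `B` into free position with `C` over `A`. Then `g ∪ h` is an
isomorphism between zero sets and extends by homogeneity. -/

namespace AbInitio

/-! ### Submodularity and the calculus of zero sets -/

section Predimension

variable {V W : Type*} {m : ℕ}

/-- The edges of `G` with both ends in `A`. -/
def edgesOn (G : SimpleGraph V) (A : Set V) : Set (Sym2 V) :=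
  {e | e ∈ G.edgeSet ∧ ∀ v ∈ e, v ∈ A}

theorem mk_mem_edgesOn {G : SimpleGraph V} {A : Set V} {x y : V} :
    s(x, y) ∈ edgesOn G A ↔ G.Adj x y ∧ x ∈ A ∧ y ∈ A := by
  simp [edgesOn]

theorem map_edgeSet_induce (G : SimpleGraph V) (A : Set V) :
    Sym2.map Subtype.val '' (G.induce A).edgeSet = edgesOn G A := by
  ext e
  induction e using Sym2.ind with
  | _ x y =>
    rw [mk_mem_edgesOn]
    constructor
    · rintro ⟨e, he, hxy⟩
      induction e using Sym2.ind with
      | _ a b =>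
        have hab : G.Adj a b := he
        rw [Sym2.map_mk, Sym2.eq_iff] at hxy
        rcases hxy with ⟨rfl, rfl⟩ | ⟨rfl, rfl⟩
        · exact ⟨hab, a.2, b.2⟩
        · exact ⟨hab.symm, b.2, a.2⟩
    · rintro ⟨h, hx, hy⟩
      exact ⟨s(⟨x, hx⟩, ⟨y, hy⟩), h, rfl⟩

theorem delta_eq (G : SimpleGraph V) (A : Set V) :
    delta m G A = (m : ℤ) * A.ncard - (edgesOn G A).ncard := by
  rw [delta, graphDelta, ← map_edgeSet_induce,
    Set.ncard_image_of_injective _ (Sym2.map.injective Subtype.val_injective),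
    Nat.card_coe_set_eq]

theorem edgesOn_finite {G : SimpleGraph V} {A : Set V} (hA : A.Finite) :
    (edgesOn G A).Finite := by
  have := hA.to_subtype
  rw [← map_edgeSet_induce]
  exact (Set.toFinite _).image _

theorem edgesOn_mono {G : SimpleGraph V} {A B : Set V} (h : A ⊆ B) :
    edgesOn G A ⊆ edgesOn G B :=
  fun _ he => ⟨he.1, fun v hv => h (he.2 v hv)⟩

theorem edgesOn_inter (G : SimpleGraph V) (A B : Set V) :
    edgesOn G (A ∩ B) = edgesOn G A ∩ edgesOn G B := by
  ext e
  simp only [edgesOn, Set.mem_ofPred_eq, Set.mem_inter_iff]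
  grind

theorem delta_image {G : SimpleGraph V} {H : SimpleGraph W} {f : W → V} {A : Set W}
    (hf : Set.InjOn f A) (h : ∀ x ∈ A, ∀ y ∈ A, G.Adj (f x) (f y) ↔ H.Adj x y) :
    delta m G (f '' A) = delta m H A := by
  have hinj : Function.Injective fun x : A => f x := fun x y hxy => Subtype.ext (hf x.2 y.2 hxy)
  rw [delta_eq, delta_eq, hf.ncard_image, ← map_edgeSet_induce H A,
    Set.ncard_image_of_injective _ (Sym2.map.injective Subtype.val_injective),
    ← Set.ncard_image_of_injective _ (Sym2.map.injective hinj)]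
  congr 3
  ext e
  induction e using Sym2.ind with
  | _ x y =>
    rw [mk_mem_edgesOn]
    constructor
    · rintro ⟨hxy, ⟨a, ha, rfl⟩, ⟨b, hb, rfl⟩⟩
      exact ⟨s(⟨a, ha⟩, ⟨b, hb⟩), (h a ha b hb).1 hxy, rfl⟩
    · rintro ⟨e, he, hxy⟩
      induction e using Sym2.ind with
      | _ a b =>
        have hab : G.Adj (f a) (f b) := (h a a.2 b b.2).2 he
        rw [Sym2.map_mk, Sym2.eq_iff] at hxy
        rcases hxy with ⟨rfl, rfl⟩ | ⟨rfl, rfl⟩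
        · exact ⟨hab, ⟨a, a.2, rfl⟩, ⟨b, b.2, rfl⟩⟩
        · exact ⟨hab.symm, ⟨b, b.2, rfl⟩, ⟨a, a.2, rfl⟩⟩

theorem delta_congr {G H : SimpleGraph V} {A : Set V}
    (h : ∀ x ∈ A, ∀ y ∈ A, G.Adj x y ↔ H.Adj x y) : delta m G A = delta m H A := by
  simpa using delta_image (m := m) (f := id) (Set.injOn_id A) h

theorem delta_image_embedding {G : SimpleGraph V} {H : SimpleGraph W} (f : H ↪g G) (A : Set W) :
    delta m G (f '' A) = delta m H A :=
  delta_image f.injective.injOn fun _ _ _ _ => f.map_adj_iff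

theorem delta_induce (G : SimpleGraph V) (S : Set V) (A : Set S) :
    delta m (G.induce S) A = delta m G (Subtype.val '' A) :=
  (delta_image Subtype.val_injective.injOn fun _ _ _ _ => Iff.rfl).symm

theorem delta_univ_induce (G : SimpleGraph V) (S : Set V) :
    delta m (G.induce S) Set.univ = delta m G S := by
  rw [delta_induce, Set.image_univ, Subtype.range_coe]

@[simp]
theorem delta_empty (G : SimpleGraph V) : delta m G ∅ = 0 := by
  have : edgesOn G ∅ = ∅ := by
    ext e
    induction e using Sym2.ind with
    | _ x y => simp [mk_mem_edgesOn]
  simp [delta_eq, this]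

/-- Inclusion-exclusion for vertices and for edges. The bracket is the defect in submodularity: it
counts the edges between `A \ B` and `B \ A`. -/
theorem delta_union_add_delta_inter_add {G : SimpleGraph V} {A B : Set V} (hA : A.Finite)
    (hB : B.Finite) :
    delta m G (A ∪ B) + delta m G (A ∩ B) +
      ((edgesOn G (A ∪ B)).ncard - (edgesOn G A ∪ edgesOn G B).ncard) =
      delta m G A + delta m G B := by
  have h1 := Set.ncard_union_add_ncard_inter A B hA hB
  have h2 := Set.ncard_union_add_ncard_inter _ _ (edgesOn_finite (G := G) hA)
    (edgesOn_finite (G := G) hB)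
  rw [← edgesOn_inter] at h2
  simp only [delta_eq]
  zify at h1 h2
  linear_combination (m : ℤ) * h1 - h2

theorem edgesOn_union_subset (G : SimpleGraph V) (A B : Set V) :
    edgesOn G A ∪ edgesOn G B ⊆ edgesOn G (A ∪ B) :=
  Set.union_subset (edgesOn_mono Set.subset_union_left) (edgesOn_mono Set.subset_union_right)

theorem delta_submodular {G : SimpleGraph V} {A B : Set V} (hA : A.Finite) (hB : B.Finite) :
    delta m G (A ∪ B) + delta m G (A ∩ B) ≤ delta m G A + delta m G B := by
  have h1 := delta_union_add_delta_inter_add (m := m) (G := G) hA hB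
  have h2 := Set.ncard_le_ncard (edgesOn_union_subset G A B) (edgesOn_finite (hA.union hB))
  zify at h2
  linarith

theorem delta_modular_of_no_cross {G : SimpleGraph V} {A B : Set V} (hA : A.Finite)
    (hB : B.Finite) (h : ∀ x ∈ A, ∀ y ∈ B, G.Adj x y → y ∈ A ∨ x ∈ B) :
    delta m G (A ∪ B) + delta m G (A ∩ B) = delta m G A + delta m G B := by
  have h1 := delta_union_add_delta_inter_add (m := m) (G := G) hA hB
  have h2 : edgesOn G (A ∪ B) = edgesOn G A ∪ edgesOn G B := by
    refine subset_antisymm ?_ (edgesOn_union_subset G A B)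
    intro e
    induction e using Sym2.ind with
    | _ x y =>
      simp only [Set.mem_union, mk_mem_edgesOn]
      have := h x
      have := h y
      have := G.adj_comm x y
      grind
  rw [h2] at h1
  linarith

/-- All finite subsets of `S` have nonnegative predimension. -/
def Sparse (m : ℕ) (G : SimpleGraph V) (S : Set V) : Prop :=
  ∀ A ⊆ S, A.Finite → 0 ≤ delta m G A

/-- A finite set of predimension zero. -/
def IsZero (m : ℕ) (G : SimpleGraph V) (A : Set V) : Prop :=
  A.Finite ∧ delta m G A = 0

variable {G : SimpleGraph V} {S A B : Set V}

theorem Sparse.mono (hS : Sparse m G S) (h : A ⊆ S) : Sparse m G A :=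
  fun _ hX => hS _ (hX.trans h)

theorem isZero_empty : IsZero m G ∅ := ⟨Set.finite_empty, delta_empty G⟩

/-- By submodularity the predimensions of union and intersection add up to at most `0`; both are
nonnegative, so both vanish. -/
theorem IsZero.union (hA : IsZero m G A) (hB : IsZero m G B) (hS : Sparse m G S) (hAS : A ⊆ S)
    (hBS : B ⊆ S) : IsZero m G (A ∪ B) := by
  have h1 := delta_submodular (m := m) (G := G) hA.1 hB.1
  have h2 := hS _ (Set.union_subset hAS hBS) (hA.1.union hB.1)
  have h3 := hS _ (Set.inter_subset_left.trans hAS) (hA.1.inter_of_left B)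
  exact ⟨hA.1.union hB.1, by linarith [hA.2, hB.2]⟩

theorem IsZero.inter (hA : IsZero m G A) (hB : IsZero m G B) (hS : Sparse m G S) (hAS : A ⊆ S)
    (hBS : B ⊆ S) : IsZero m G (A ∩ B) := by
  have h1 := delta_submodular (m := m) (G := G) hA.1 hB.1
  have h2 := hS _ (Set.union_subset hAS hBS) (hA.1.union hB.1)
  have h3 := hS _ (Set.inter_subset_left.trans hAS) (hA.1.inter_of_left B)
  exact ⟨hA.1.inter_of_left B, by linarith [hA.2, hB.2]⟩

theorem IsZero.biUnion {ι : Type*} {t : Set ι} (ht : t.Finite) {Z : ι → Set V}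
    (hZ : ∀ i ∈ t, IsZero m G (Z i)) (hS : Sparse m G S) (hZS : ∀ i ∈ t, Z i ⊆ S) :
    IsZero m G (⋃ i ∈ t, Z i) := by
  induction t, ht using Set.Finite.induction_on with
  | empty => simpa using isZero_empty
  | @insert a s _ _ ih =>
    rw [Set.biUnion_insert]
    have h1 := fun i (hi : i ∈ s) => hZ i (Set.mem_insert_of_mem _ hi)
    have h2 := fun i (hi : i ∈ s) => hZS i (Set.mem_insert_of_mem _ hi)
    exact (hZ a (Set.mem_insert _ _)).union (ih h1 h2) hS (hZS a (Set.mem_insert _ _))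
      (Set.iUnion₂_subset h2)

/-- There are no edges across two sets of predimension zero. -/
theorem IsZero.no_cross (hA : IsZero m G A) (hB : IsZero m G B) (hS : Sparse m G S) (hAS : A ⊆ S)
    (hBS : B ⊆ S) {x y : V} (hx : x ∈ A) (hy : y ∈ B) (hxy : G.Adj x y) : y ∈ A ∨ x ∈ B := by
  by_contra! hn
  have h1 := delta_union_add_delta_inter_add (m := m) (G := G) hA.1 hB.1
  have h2 := (hA.union hB hS hAS hBS).2
  have h3 := (hA.inter hB hS hAS hBS).2
  have h4 : edgesOn G A ∪ edgesOn G B ⊂ edgesOn G (A ∪ B) := by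
    refine (Set.ssubset_iff_of_subset (edgesOn_union_subset G A B)).2 ⟨s(x, y), ?_, ?_⟩
    · exact mk_mem_edgesOn.2 ⟨hxy, Or.inl hx, Or.inr hy⟩
    · simp [mk_mem_edgesOn, hn.1, hn.2]
  have h5 := Set.ncard_lt_ncard h4 (edgesOn_finite (hA.1.union hB.1))
  zify at h5
  linarith [hA.2, hB.2]

/-- Free amalgamation over a set of predimension zero preserves sparsity. -/
theorem Sparse.union (hA : Sparse m G A) (hB : Sparse m G B) (hAB : IsZero m G (A ∩ B))
    (hcross : ∀ x ∈ A, ∀ y ∈ B, G.Adj x y → y ∈ A ∨ x ∈ B) : Sparse m G (A ∪ B) := by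
  intro X hX hfin
  have h1 := delta_modular_of_no_cross (m := m) (G := G) (hfin.inter_of_left A)
    (hfin.inter_of_left B) fun x hx y hy hxy =>
      (hcross x hx.2 y hy.2 hxy).imp (fun h => ⟨hy.1, h⟩) (fun h => ⟨hx.1, h⟩)
  rw [← Set.inter_union_distrib_left, Set.inter_eq_left.2 hX, ← Set.inter_inter_distrib_left] at h1
  -- Comparing `X ∩ B` with the zero set `A ∩ B` gives `δ(X ∩ A ∩ B) ≤ δ(X ∩ B)`, so the modular
  -- identity leaves `δ(X) ≥ δ(X ∩ A)`.
  have h2 := delta_submodular (m := m) (G := G) (hfin.inter_of_left B) hAB.1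
  have h3 : X ∩ B ∩ (A ∩ B) = X ∩ (A ∩ B) := by grind
  rw [h3] at h2
  have h4 := hB _ (Set.union_subset Set.inter_subset_right Set.inter_subset_right)
    ((hfin.inter_of_left B).union hAB.1)
  have h5 := hA _ Set.inter_subset_right (hfin.inter_of_left A)
  linarith [hAB.2]

/-- A union of sparse zero sets that meet in zero sets and cover all edges is sparse. -/
theorem sparse_biUnion {ι : Type*} {R : ι → Set V}
    (hsp : ∀ i, Sparse m G (R i)) (hinter : ∀ i j, IsZero m G (R i ∩ R j))
    (hedge : ∀ x y, G.Adj x y → ∃ i, x ∈ R i ∧ y ∈ R i) {t : Set ι} (ht : t.Finite) :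
    Sparse m G (⋃ i ∈ t, R i) := by
  have key : ∀ {s : Set ι}, s.Finite → ∀ i, IsZero m G (R i ∩ ⋃ j ∈ s, R j) := by
    intro s hs i
    rw [Set.inter_iUnion₂]
    exact IsZero.biUnion hs (fun j _ => hinter i j) (hsp i) fun _ _ => Set.inter_subset_left
  induction t, ht using Set.Finite.induction_on with
  | empty =>
    intro X hX _
    simp only [Set.mem_empty_iff_false, Set.iUnion_of_empty, Set.iUnion_empty,
      Set.subset_empty_iff] at hX
    simp [hX]
  | @insert a s _ hs ih =>
    rw [Set.biUnion_insert]
    refine (hsp a).union ih (key hs a) fun x hx y hy hxy => ?_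
    obtain ⟨i, hxi, hyi⟩ := hedge x y hxy
    -- The edge lies in a single `R i`, where `R a` and the union built so far both cut out zero
    -- sets.
    exact ((hinter i a).no_cross (key hs i) (hsp i) Set.inter_subset_left Set.inter_subset_left
      ⟨hxi, hx⟩ ⟨hyi, hy⟩ hxy).imp And.right And.right

end Predimension

/-! ### Extending partial isomorphisms: gluing all zero graphs on a finite set -/

section ExtendingPartialIsomorphisms

variable {W : Type*} {m : ℕ}

/-- The sparse graphs of predimension zero with vertex set `W`. -/
def ZeroGraph (m : ℕ) (W : Type*) : Type _ :=
  {K : SimpleGraph W // Sparse m K Set.univ ∧ IsZero m K Set.univ}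

/-- Two pointed graphs on `W` are identified if they have the same point, and coincide on a
common subset of predimension zero that contains this point. -/
def germSetoid (m : ℕ) (W : Type*) : Setoid (W × ZeroGraph m W) where
  r x y := x.1 = y.1 ∧ ∃ Z : Set W, x.1 ∈ Z ∧ IsZero m x.2.1 Z ∧
    ∀ a ∈ Z, ∀ b ∈ Z, x.2.1.Adj a b ↔ y.2.1.Adj a b
  iseqv :=
    { refl := fun x => ⟨rfl, Set.univ, trivial, x.2.2.2, fun _ _ _ _ => Iff.rfl⟩
      symm := by
        rintro ⟨x, K⟩ ⟨y, K'⟩ ⟨rfl, Z, hx, hZ, h⟩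
        exact ⟨rfl, Z, hx, ⟨hZ.1, (delta_congr h).symm.trans hZ.2⟩,
          fun a ha b hb => (h a ha b hb).symm⟩
      trans := by
        rintro ⟨x, K⟩ ⟨y, K'⟩ ⟨z, K''⟩ ⟨rfl, Z, hx, hZ, h⟩ ⟨rfl, Z', hy, hZ', h'⟩
        have hzero : IsZero m K'.1 Z := ⟨hZ.1, (delta_congr h).symm.trans hZ.2⟩
        -- Transitivity is where zero sets matter: the two regions of agreement may be intersected
        -- inside the middle graph.
        have hint := hzero.inter hZ' K'.2.1 (Set.subset_univ _) (Set.subset_univ _)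
        refine ⟨rfl, Z ∩ Z', ⟨hx, hy⟩, ⟨hint.1, ?_⟩, fun a ha b hb =>
          (h a ha.1 b hb.1).trans (h' a ha.2 b hb.2)⟩
        exact (delta_congr fun a ha b hb => h a ha.1 b hb.1).trans hint.2 }

/-- The germs of pointed sparse graphs of predimension zero on the vertex set `W`. -/
def Germ (m : ℕ) (W : Type*) : Type _ := Quotient (germSetoid m W)

/-- The germ of the graph `K` at the point `x`. -/
def germ (K : ZeroGraph m W) (x : W) : Germ m W := Quotient.mk (germSetoid m W) (x, K)

theorem germ_eq_iff {K K' : ZeroGraph m W} {x y : W} : germ K x = germ K' y ↔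
    x = y ∧ ∃ Z : Set W, x ∈ Z ∧ IsZero m K.1 Z ∧
      ∀ a ∈ Z, ∀ b ∈ Z, K.1.Adj a b ↔ K'.1.Adj a b :=
  Quotient.eq (r := germSetoid m W)

theorem germ_injective (K : ZeroGraph m W) : Function.Injective (germ K) :=
  fun _ _ h => (germ_eq_iff.1 h).1

theorem exists_germ (x : Germ m W) : ∃ K a, germ K a = x :=
  Quotient.inductionOn x fun p => ⟨p.2, p.1, rfl⟩

instance [Finite W] : Finite (ZeroGraph m W) := inferInstanceAs (Finite (Subtype _))

instance [Finite W] : Finite (Germ m W) := inferInstanceAs (Finite (Quotient _))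

/-- The graph of all germs: the union of all sparse graphs of predimension zero on `W`. -/
def germGraph (m : ℕ) (W : Type*) : SimpleGraph (Germ m W) where
  Adj x y := ∃ (K : ZeroGraph m W) (a b : W), K.1.Adj a b ∧ germ K a = x ∧ germ K b = y
  symm := ⟨fun _ _ ⟨K, a, b, h, ha, hb⟩ => ⟨K, b, a, h.symm, hb, ha⟩⟩
  loopless := ⟨fun _ ⟨K, _, _, h, ha, hb⟩ => h.ne (germ_injective K (ha.trans hb.symm))⟩

/-- Gluing adds no edges to a copy. An edge coming from `K'` has ends in zero sets `Z`, `Z'` on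
which `K'` agrees with `K`; as no edge crosses two zero sets, one of them contains both ends. -/
theorem germGraph_adj {K : ZeroGraph m W} {x y : W} :
    (germGraph m W).Adj (germ K x) (germ K y) ↔ K.1.Adj x y := by
  refine ⟨?_, fun h => ⟨K, x, y, h, rfl, rfl⟩⟩
  rintro ⟨K', a, b, hab, ha, hb⟩
  obtain ⟨rfl, Z, hZ, hZ0, hadj⟩ := germ_eq_iff.1 ha
  obtain ⟨rfl, Z', hZ', hZ0', hadj'⟩ := germ_eq_iff.1 hb
  rcases hZ0.no_cross hZ0' K'.2.1 (Set.subset_univ _) (Set.subset_univ _) hZ hZ' hab with h | h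
  · exact (hadj a hZ b h).1 hab
  · exact (hadj' a h b hZ').1 hab

/-- The graph `K` as a subgraph of the graph of germs. -/
def germEmbedding (K : ZeroGraph m W) : K.1 ↪g germGraph m W where
  toFun := germ K
  inj' := germ_injective K
  map_rel_iff' := germGraph_adj

theorem IsZero.image {V : Type*} {H : SimpleGraph W} {G : SimpleGraph V} (f : H ↪g G) {A : Set W}
    (hA : IsZero m H A) : IsZero m G (f '' A) :=
  ⟨hA.1.image f, (delta_image_embedding f A).trans hA.2⟩

theorem Sparse.image {V : Type*} {H : SimpleGraph W} {G : SimpleGraph V} (f : H ↪g G) {A : Set W}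
    (hA : Sparse m H A) : Sparse m G (f '' A) := by
  intro X hX hfin
  obtain ⟨Y, hY, rfl⟩ := Set.subset_image_iff.1 hX
  rw [delta_image_embedding]
  exact hA Y hY (hfin.of_finite_image f.injective.injOn)

theorem isZero_agreement [Finite W] (K K' : ZeroGraph m W) :
    IsZero m K.1 {x | germ K x = germ K' x} := by
  set t : Set (Set W) := {Z | IsZero m K.1 Z ∧ ∀ a ∈ Z, ∀ b ∈ Z, K.1.Adj a b ↔ K'.1.Adj a b}
    with ht
  have : {x | germ K x = germ K' x} = ⋃ Z ∈ t, Z := by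
    ext x
    simp only [Set.mem_ofPred_eq, germ_eq_iff, true_and, Set.mem_iUnion, ht]
    exact exists_congr fun Z => ⟨fun h => ⟨h.2, h.1⟩, fun ⟨h, h'⟩ => ⟨h', h⟩⟩
  rw [this]
  exact IsZero.biUnion (Set.toFinite t) (fun Z hZ => hZ.1) K.2.1 fun _ _ => Set.subset_univ _

/-- The copies of the graphs on `W` cover all vertices and edges, and two copies meet exactly in the
germs of their agreement set, which is zero. Hence `sparse_biUnion` applies. -/
theorem sparse_germGraph [Finite W] : Sparse m (germGraph m W) Set.univ ∧
    IsZero m (germGraph m W) Set.univ := by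
  have hzero (K : ZeroGraph m W) : IsZero m (germGraph m W) (Set.range (germ K)) :=
    Set.image_univ (f := germ K) ▸ K.2.2.image (germEmbedding K)
  have hsparse (K : ZeroGraph m W) : Sparse m (germGraph m W) (Set.range (germ K)) :=
    Set.image_univ (f := germ K) ▸ K.2.1.image (germEmbedding K)
  have hcover : ⋃ K ∈ (Set.univ : Set (ZeroGraph m W)), Set.range (germ K) = Set.univ := by
    refine Set.eq_univ_of_forall fun x => ?_
    obtain ⟨K, a, rfl⟩ := exists_germ x
    exact Set.mem_biUnion (Set.mem_univ K) ⟨a, rfl⟩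
  have hsp : Sparse m (germGraph m W) Set.univ := by
    rw [← hcover]
    refine sparse_biUnion hsparse (fun K K' => ?_) ?_ Set.finite_univ
    · have : Set.range (germ K) ∩ Set.range (germ K') = germ K '' {x | germ K x = germ K' x} := by
        ext x
        constructor
        · rintro ⟨⟨a, rfl⟩, ⟨b, hb⟩⟩
          obtain rfl := (germ_eq_iff.1 hb).1
          exact ⟨b, hb.symm, rfl⟩
        · rintro ⟨a, ha, rfl⟩
          exact ⟨⟨a, rfl⟩, ⟨a, Eq.symm ha⟩⟩
      rw [this]
      exact (isZero_agreement K K').image (germEmbedding K)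
    · rintro x y ⟨K, a, b, -, rfl, rfl⟩
      exact ⟨K, ⟨a, rfl⟩, ⟨b, rfl⟩⟩
  refine ⟨hsp, ?_⟩
  rw [← hcover]
  exact IsZero.biUnion Set.finite_univ (fun K _ => hzero K) hsp fun _ _ => Set.subset_univ _

/-- The image of a graph under a permutation of its vertices. -/
def ZeroGraph.perm (s : Equiv.Perm W) (K : ZeroGraph m W) : ZeroGraph m W :=
  ⟨K.1.comap s.symm, by
    have h1 := K.2.1.image (SimpleGraph.Iso.comap s.symm K.1).symm.toEmbedding
    have h2 := K.2.2.image (SimpleGraph.Iso.comap s.symm K.1).symm.toEmbedding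
    simp only [Set.image_univ] at h1 h2
    have : Set.range (SimpleGraph.Iso.comap s.symm K.1).symm.toEmbedding = Set.univ :=
      (SimpleGraph.Iso.comap s.symm K.1).symm.surjective.range_eq
    rw [this] at h1 h2
    exact ⟨h1, h2⟩⟩

theorem ZeroGraph.perm_adj (s : Equiv.Perm W) (K : ZeroGraph m W) (x y : W) :
    (K.perm s).1.Adj (s x) (s y) ↔ K.1.Adj x y := by
  simp [ZeroGraph.perm]

theorem ZeroGraph.perm_symm_perm (s : Equiv.Perm W) (K : ZeroGraph m W) :
    (K.perm s).perm s.symm = K := by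
  apply Subtype.ext
  ext x y
  simp [ZeroGraph.perm]

theorem germ_perm_eq (s : Equiv.Perm W) {K K' : ZeroGraph m W} {x y : W}
    (h : germ K x = germ K' y) : germ (K.perm s) (s x) = germ (K'.perm s) (s y) := by
  obtain ⟨rfl, Z, hx, hZ, hadj⟩ := germ_eq_iff.1 h
  refine germ_eq_iff.2 ⟨rfl, s '' Z, ⟨x, hx, rfl⟩, ⟨hZ.1.image s, ?_⟩, ?_⟩
  · exact (delta_image s.injective.injOn fun a _ b _ => K.perm_adj s a b).trans hZ.2
  · rintro _ ⟨a, ha, rfl⟩ _ ⟨b, hb, rfl⟩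
    rw [ZeroGraph.perm_adj, ZeroGraph.perm_adj, hadj a ha b hb]

/-- The map on germs induced by a permutation of the vertices. -/
def germMap (s : Equiv.Perm W) : Germ m W → Germ m W :=
  Quotient.lift (fun p => germ (p.2.perm s) (s p.1)) fun p q h =>
    germ_perm_eq (K := p.2) (K' := q.2) s (Quotient.sound h)

theorem germMap_germ (s : Equiv.Perm W) (K : ZeroGraph m W) (x : W) :
    germMap s (germ K x) = germ (K.perm s) (s x) := rfl

theorem germMap_symm_germMap (s : Equiv.Perm W) (x : Germ m W) :
    germMap s.symm (germMap s x) = x := by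
  obtain ⟨K, a, rfl⟩ := exists_germ x
  simp [germMap_germ, ZeroGraph.perm_symm_perm]

theorem germMap_adj (s : Equiv.Perm W) {x y : Germ m W} (h : (germGraph m W).Adj x y) :
    (germGraph m W).Adj (germMap s x) (germMap s y) := by
  obtain ⟨K, a, b, hab, rfl, rfl⟩ := h
  exact germGraph_adj.2 ((K.perm_adj s a b).2 hab)

/-- The automorphism of the graph of germs induced by a permutation of the vertices. -/
def germIso (s : Equiv.Perm W) : germGraph m W ≃g germGraph m W where
  toFun := germMap s
  invFun := germMap s.symm
  left_inv := germMap_symm_germMap s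
  right_inv := germMap_symm_germMap s.symm
  map_rel_iff' := fun {x y} => ⟨fun h => by
    have h' := germMap_adj s.symm h
    rwa [Equiv.coe_fn_mk, germMap_symm_germMap, germMap_symm_germMap] at h', germMap_adj s⟩

theorem exists_perm_extending [Finite W] {D : Set W} {f : D → W} (hf : Function.Injective f) :
    ∃ s : Equiv.Perm W, ∀ x : D, s x = f x := by
  classical
  have := Fintype.ofFinite W
  let e : {x // x ∈ D} ≃ {x // x ∈ Set.range f} := Equiv.ofInjective f hf
  refine ⟨e.extendSubtype, fun x => ?_⟩
  rw [Equiv.extendSubtype_apply_of_mem e x x.2]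
  rfl

/-- Every sparse graph of predimension zero embeds in another one, such that all isomorphisms
between subsets of predimension zero extend to automorphisms. -/
theorem exists_extending_partial_isomorphisms {W : Type*} [Finite W] (H : SimpleGraph W)
    (hsp : Sparse m H Set.univ) (hzero : IsZero m H Set.univ) :
    ∃ j : H ↪g germGraph m W, ∀ (D : Set W) (f : D → W), IsZero m H D → Function.Injective f →
      (∀ x y : D, H.Adj (f x) (f y) ↔ H.Adj x y) →
      ∃ p : germGraph m W ≃g germGraph m W, ∀ x : D, p (j x) = j (f x) := by
  let K : ZeroGraph m W := ⟨H, hsp, hzero⟩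
  refine ⟨germEmbedding K, fun D f hD hf hadj => ?_⟩
  obtain ⟨s, hs⟩ := exists_perm_extending hf
  refine ⟨germIso s, fun x => ?_⟩
  -- `K` and its permuted copy agree on `s '' D`, since `f` is an isomorphism onto its image there;
  -- so their germs coincide at the points of the image.
  have : germ (K.perm s) (s x) = germ K (f x) := by
    refine germ_eq_iff.2 ⟨hs x, s '' D, ⟨x, x.2, rfl⟩, ⟨hD.1.image s, ?_⟩, ?_⟩
    · exact (delta_image s.injective.injOn fun a _ b _ => K.perm_adj s a b).trans hD.2
    · rintro _ ⟨a, ha, rfl⟩ _ ⟨b, hb, rfl⟩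
      rw [ZeroGraph.perm_adj, hs ⟨a, ha⟩, hs ⟨b, hb⟩]
      exact (hadj ⟨a, ha⟩ ⟨b, hb⟩).symm
  exact this

end ExtendingPartialIsomorphisms

/-! ### The graph `gcl(∅)` as a generic structure for zero graphs -/

section Hat

variable {V U : Type*} {m : ℕ}

/-- The properties of the countable graph that is generic for sparse graphs of predimension
zero. -/
structure ZeroGeneric (m : ℕ) (G : SimpleGraph U) : Prop where
  countable : Countable U
  sparse : Sparse m G Set.univ
  exists_isZero : ∀ v, ∃ Z, v ∈ Z ∧ IsZero m G Z
  homogeneous : ∀ S, IsZero m G S → ∀ u : S → U, Function.Injective u →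
    (∀ x y : S, G.Adj (u x) (u y) ↔ G.Adj x y) → ∃ σ : G ≃g G, ∀ x : S, σ x = u x
  universal : ∀ (W : Type) (H : SimpleGraph W), Sparse m H Set.univ → IsZero m H Set.univ →
    Nonempty (H ↪g G)

theorem isClosedSet_empty {G : SimpleGraph V} (hG : IsGeneric m G) : IsClosedSet m G ∅ := by
  obtain ⟨f, hf⟩ := hG.universal Empty ⊥ ⟨inferInstance, fun A => by
    rw [Set.eq_empty_of_isEmpty A, delta_empty]⟩
  rwa [Set.range_eq_empty] at hf

theorem IsGeneric.sparse {G : SimpleGraph V} (hG : IsGeneric m G) : Sparse m G Set.univ := by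
  intro X _ hX
  have := ((isClosedSet_empty hG).2 X hX (Set.empty_subset _)).2 X (Set.empty_subset _) subset_rfl
  rwa [delta_empty] at this

/-- Zero is the least possible predimension. This is what makes the homogeneity of the generic graph
available for zero sets. -/
theorem IsZero.isClosedSet {G : SimpleGraph V} (hG : Sparse m G Set.univ) {A : Set V}
    (hA : IsZero m G A) : IsClosedSet m G A :=
  ⟨hA.1, fun _ hB hAB => ⟨hAB, fun X _ hXB =>
    hA.2.trans_le (hG X (Set.subset_univ _) (hB.subset hXB))⟩⟩

theorem IsClosedSet.delta_le {G : SimpleGraph V} {A X : Set V} (hA : IsClosedSet m G A)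
    (hX : X.Finite) (h : A ⊆ X) : delta m G A ≤ delta m G X :=
  (hA.2 X hX h).2 X h subset_rfl

/-- For `X ⊇ A ∩ B`, submodularity and closedness of `A` give `δ(X ∩ A) ≤ δ(X)`; the same argument
with `B` gives `δ(A ∩ B) ≤ δ(X ∩ A)`. -/
theorem IsClosedSet.inter {G : SimpleGraph V} {A B : Set V} (hA : IsClosedSet m G A)
    (hB : IsClosedSet m G B) : IsClosedSet m G (A ∩ B) := by
  refine ⟨hA.1.inter_of_left B, fun Y hY hABY => ⟨hABY, fun X hX hXY => ?_⟩⟩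
  have hXfin := hY.subset hXY
  have h1 := delta_submodular (m := m) (G := G) hXfin hA.1
  have h2 := delta_submodular (m := m) (G := G) (hXfin.inter_of_left A) hB.1
  have h3 : X ∩ A ∩ B = A ∩ B := by grind
  rw [h3] at h2
  have h4 := hA.delta_le (hXfin.union hA.1) Set.subset_union_right
  have h5 := hB.delta_le ((hXfin.inter_of_left A).union hB.1) Set.subset_union_right
  linarith

theorem isClosedSet_cl {G : SimpleGraph V} (hG : IsGeneric m G) (v : V) :
    IsClosedSet m G (cl m G {v}) := by
  obtain ⟨s, -, hs, hU⟩ := hG.exists_chain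
  obtain ⟨i, hi⟩ := Set.mem_iUnion.1 (hU.symm ▸ Set.mem_univ v : v ∈ ⋃ i, s i)
  -- A closed set of least cardinality is contained in every other one, since intersections of
  -- closed sets are closed.
  obtain ⟨C, ⟨hvC, hC⟩, hmin⟩ := WellFounded.has_min
    (InvImage.wf (fun C : Set V => C.ncard) Nat.lt_wfRel.wf)
    {C | {v} ⊆ C ∧ IsClosedSet m G C} ⟨s i, Set.singleton_subset_iff.2 hi, hs i⟩
  have : cl m G {v} = C := by
    refine subset_antisymm (Set.sInter_subset_of_mem ⟨hvC, hC⟩) (Set.subset_sInter ?_)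
    rintro C' ⟨hvC', hC'⟩
    have h1 : C.ncard ≤ (C ∩ C').ncard :=
      not_lt.1 (hmin (C ∩ C') ⟨Set.subset_inter hvC hvC', hC.inter hC'⟩)
    have h2 := Set.eq_of_subset_of_ncard_le Set.inter_subset_left h1 hC.1
    exact Set.inter_eq_left.1 h2
  rwa [this]

/-- The elements of `gcl ∅` are those which lie in a finite set of predimension zero. -/
theorem mem_gcl_empty_iff {G : SimpleGraph V} (hG : IsGeneric m G) {v : V} :
    v ∈ gcl m G ∅ ↔ ∃ Z, v ∈ Z ∧ IsZero m G Z := by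
  have h0 : dim m G ∅ = 0 := by
    have : cl m G ∅ = ∅ := Set.subset_empty_iff.1
      (Set.sInter_subset_of_mem ⟨subset_rfl, isClosedSet_empty hG⟩)
    rw [dim, this, delta_empty]
  have hv : v ∈ cl m G {v} := Set.mem_sInter.2 fun C hC => hC.1 rfl
  have hcl := isClosedSet_cl hG v
  constructor
  · rintro ⟨A, -, hA, hd⟩
    obtain rfl := Set.subset_empty_iff.1 hA
    rw [h0, sub_zero, insert_empty_eq] at hd
    exact ⟨_, hv, hcl.1, hd⟩
  · rintro ⟨Z, hvZ, hZ⟩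
    refine ⟨∅, Set.finite_empty, subset_rfl, ?_⟩
    rw [h0, sub_zero, insert_empty_eq]
    have hsub : cl m G {v} ⊆ Z := Set.sInter_subset_of_mem
      ⟨Set.singleton_subset_iff.2 hvZ, hZ.isClosedSet hG.sparse⟩
    exact le_antisymm ((hcl.delta_le hZ.1 hsub).trans_eq hZ.2)
      (hG.sparse _ (Set.subset_univ _) hcl.1)

theorem isZero_induce_iff {G : SimpleGraph V} {S : Set V} {A : Set S} :
    IsZero m (G.induce S) A ↔ IsZero m G (Subtype.val '' A) := by
  rw [IsZero, IsZero, delta_induce, Set.finite_image_iff Subtype.val_injective.injOn]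

theorem Sparse.induce {G : SimpleGraph V} (hG : Sparse m G Set.univ) (S : Set V) :
    Sparse m (G.induce S) Set.univ := by
  intro X _ hX
  rw [delta_induce]
  exact hG _ (Set.subset_univ _) (hX.image _)

theorem iso_mem_gcl_empty {G : SimpleGraph V} (hG : IsGeneric m G) (σ : G ≃g G) {v : V}
    (hv : v ∈ gcl m G ∅) : σ v ∈ gcl m G ∅ := by
  obtain ⟨Z, hvZ, hZ⟩ := (mem_gcl_empty_iff hG).1 hv
  exact (mem_gcl_empty_iff hG).2 ⟨σ '' Z, ⟨v, hvZ, rfl⟩, hZ.image σ.toEmbedding⟩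

theorem zeroGeneric_hatGraph {G : SimpleGraph V} (hG : IsGeneric m G) :
    ZeroGeneric m (hatGraph m G) where
  countable := by
    have := hG.countable
    exact inferInstanceAs (Countable (gcl m G ∅))
  sparse := hG.sparse.induce _
  exists_isZero := by
    rintro ⟨v, hv⟩
    obtain ⟨Z, hvZ, hZ⟩ := (mem_gcl_empty_iff hG).1 hv
    have hsub : Z ⊆ gcl m G ∅ := fun w hw => (mem_gcl_empty_iff hG).2 ⟨Z, hw, hZ⟩
    have himage : Subtype.val '' (Subtype.val ⁻¹' Z : Set (gcl m G ∅)) = Z := by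
      rw [Subtype.image_preimage_coe, Set.inter_eq_right.2 hsub]
    exact ⟨Subtype.val ⁻¹' Z, hvZ, isZero_induce_iff.2 (himage.symm ▸ hZ)⟩
  homogeneous := by
    intro S hS u hu hadj
    have hS' := isZero_induce_iff.1 hS
    let w : S → V := fun x => (u x).1
    have hw : Function.Injective w := Subtype.val_injective.comp hu
    let e1 : S ≃ (Subtype.val '' S : Set V) := Equiv.Set.image _ S Subtype.val_injective
    let e2 : S ≃ Set.range w := Equiv.ofInjective w hw
    -- The image is isomorphic to `S`, hence zero and therefore closed, as homogeneity requires.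
    have hr : IsZero m G (Set.range w) := by
      have h1 : delta m G (w '' Set.univ) = delta m ((hatGraph m G).induce S) Set.univ :=
        delta_image hw.injOn fun x _ y _ => hadj x y
      rw [delta_univ_induce, hS.2, Set.image_univ] at h1
      have := hS.1.to_subtype
      exact ⟨Set.finite_range w, h1⟩
    have hadj' : ∀ x y : S, G.Adj (e2 x) (e2 y) ↔ G.Adj (e1 x) (e1 y) := hadj
    let e : G.induce (Subtype.val '' S : Set V) ≃g G.induce (Set.range w) :=
      ⟨e1.symm.trans e2, fun {x y} => by
        have := hadj' (e1.symm x) (e1.symm y)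
        rwa [e1.apply_symm_apply, e1.apply_symm_apply] at this⟩
    obtain ⟨σ, hσ⟩ := hG.homogeneous _ _ (hS'.isClosedSet hG.sparse) (hr.isClosedSet hG.sparse) e
    let τ : hatGraph m G ≃g hatGraph m G :=
      { toFun := fun x => ⟨σ x.1, iso_mem_gcl_empty hG σ x.2⟩
        invFun := fun x => ⟨σ.symm x.1, iso_mem_gcl_empty hG σ.symm x.2⟩
        left_inv := fun x => Subtype.ext (σ.symm_apply_apply x.1)
        right_inv := fun x => Subtype.ext (σ.apply_symm_apply x.1)
        map_rel_iff' := σ.map_rel_iff }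
    refine ⟨τ, fun x => Subtype.ext ?_⟩
    have h1 : σ (e1 x) = e (e1 x) := hσ (e1 x)
    have h2 : e (e1 x) = e2 x := congrArg e2 (e1.symm_apply_apply x)
    rw [h2] at h1
    exact h1
  universal := by
    intro W H hsp hz
    have hfin : Finite W := Set.finite_univ_iff.1 hz.1
    obtain ⟨f, hf⟩ := hG.universal W H ⟨hfin, fun A => hsp A (Set.subset_univ _) (Set.toFinite A)⟩
    have hzero : IsZero m G (Set.range f) := Set.image_univ (f := f) ▸ hz.image f
    have hmem (x : W) : f x ∈ gcl m G ∅ := (mem_gcl_empty_iff hG).2 ⟨_, Set.mem_range_self x, hzero⟩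
    let g : H ↪g hatGraph m G :=
      { toFun := fun x => ⟨f x, hmem x⟩
        inj' := fun x y h => f.injective (congrArg Subtype.val h)
        map_rel_iff' := f.map_rel_iff }
    exact ⟨g⟩

variable {G : SimpleGraph U}

/-- Universality concerns graphs in `Type`; a copy on `Fin n` removes this restriction on the
universe. -/
theorem ZeroGeneric.exists_embedding (hG : ZeroGeneric m G) {W : Type*} (H : SimpleGraph W)
    (hsp : Sparse m H Set.univ) (hz : IsZero m H Set.univ) : Nonempty (H ↪g G) := by
  have hfin : Finite W := Set.finite_univ_iff.1 hz.1
  obtain ⟨n, ⟨e⟩⟩ := Finite.exists_equiv_fin W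
  let i : H.comap e.symm ≃g H := SimpleGraph.Iso.comap e.symm H
  have h1 := hsp.image i.symm.toEmbedding
  have h2 := hz.image i.symm.toEmbedding
  have h3 : (i.symm.toEmbedding '' Set.univ) = Set.univ := by
    rw [Set.image_univ]
    exact i.symm.surjective.range_eq
  rw [h3] at h1 h2
  obtain ⟨f⟩ := hG.universal _ _ h1 h2
  exact ⟨f.comp i.symm.toEmbedding⟩

/-- A sparse graph of predimension zero embeds over any given copy of a subset of predimension
zero. -/
theorem ZeroGeneric.exists_embedding_over (hG : ZeroGeneric m G) {W : Type*} (H : SimpleGraph W)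
    (hsp : Sparse m H Set.univ) (hz : IsZero m H Set.univ) {S : Set U} (hS : IsZero m G S)
    (j : G.induce S ↪g H) : ∃ f : H ↪g G, ∀ x : S, f (j x) = x := by
  obtain ⟨f⟩ := hG.exists_embedding H hsp hz
  -- An arbitrary embedding puts `S` somewhere; homogeneity provides an automorphism doing the same,
  -- which is then undone.
  obtain ⟨σ, hσ⟩ := hG.homogeneous S hS (fun x => f (j x)) (f.injective.comp j.injective)
    fun x y => f.map_adj_iff.trans j.map_adj_iff
  refine ⟨σ.symm.toEmbedding.comp f, fun x => ?_⟩
  change σ.symm (f (j x)) = x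
  rw [← hσ x, σ.symm_apply_apply]

theorem ZeroGeneric.exists_isZero_superset (hG : ZeroGeneric m G) {X : Set U} (hX : X.Finite) :
    ∃ Z, X ⊆ Z ∧ IsZero m G Z := by
  choose Z hZ hz using hG.exists_isZero
  exact ⟨⋃ x ∈ X, Z x, fun x hx => Set.mem_biUnion hx (hZ x),
    IsZero.biUnion hX (fun x _ => hz x) hG.sparse fun _ _ => Set.subset_univ _⟩

end Hat

/-! ### Free amalgamation over a zero set -/

section FreeAmalgam

variable {U : Type*} {m : ℕ} {G : SimpleGraph U}

/-- The free amalgam of the subgraphs induced on `B` and `C` over `A`. -/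
def freeAmalgam (G : SimpleGraph U) (A B C : Set U) : SimpleGraph (B ⊕ ↥(C \ A)) where
  Adj
    | .inl x, .inl y => G.Adj x y
    | .inl x, .inr y => x.1 ∈ A ∧ G.Adj x y
    | .inr x, .inl y => y.1 ∈ A ∧ G.Adj x y
    | .inr x, .inr y => G.Adj x y
  symm := ⟨by
    rintro (x | x) (y | y) h
    exacts [G.adj_symm h, ⟨h.1, G.adj_symm h.2⟩, ⟨h.1, G.adj_symm h.2⟩, G.adj_symm h]⟩
  loopless := ⟨by
    rintro (x | x) h
    exacts [G.irrefl h, G.irrefl h]⟩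

/-- The inclusion of the first factor in the free amalgam. -/
def freeAmalgamLeft (G : SimpleGraph U) (A B C : Set U) :
    G.induce B ↪g freeAmalgam G A B C where
  toFun := Sum.inl
  inj' := Sum.inl_injective
  map_rel_iff' := Iff.rfl

open Classical in
/-- The map from the second factor to the free amalgam. -/
noncomputable def freeAmalgamMap {A B : Set U} (C : Set U) (hAB : A ⊆ B) (x : C) : B ⊕ ↥(C \ A) :=
  if h : x.1 ∈ A then .inl ⟨x.1, hAB h⟩ else .inr ⟨x.1, x.2, h⟩

theorem freeAmalgamMap_of_mem {A B C : Set U} (hAB : A ⊆ B) {x : U} (hC : x ∈ C) (hx : x ∈ A) :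
    freeAmalgamMap C hAB ⟨x, hC⟩ = .inl ⟨x, hAB hx⟩ := dif_pos hx

theorem freeAmalgamMap_of_notMem {A B C : Set U} (hAB : A ⊆ B) {x : U} (hC : x ∈ C)
    (hx : x ∉ A) : freeAmalgamMap C hAB ⟨x, hC⟩ = .inr ⟨x, hC, hx⟩ := dif_neg hx

theorem elim_freeAmalgamMap {A B C : Set U} (hAB : A ⊆ B) (x : C) :
    Sum.elim Subtype.val Subtype.val (freeAmalgamMap C hAB x) = x.1 := by
  by_cases h : x.1 ∈ A
  · rw [freeAmalgamMap_of_mem hAB x.2 h, Sum.elim_inl]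
  · rw [freeAmalgamMap_of_notMem hAB x.2 h, Sum.elim_inr]

theorem freeAmalgamMap_adj {A B C : Set U} (hAB : A ⊆ B) (x y : C) :
    (freeAmalgam G A B C).Adj (freeAmalgamMap C hAB x) (freeAmalgamMap C hAB y) ↔
      G.Adj x y := by
  by_cases hx : x.1 ∈ A <;> by_cases hy : y.1 ∈ A
  · rw [freeAmalgamMap_of_mem hAB x.2 hx, freeAmalgamMap_of_mem hAB y.2 hy]
    exact Iff.rfl
  · rw [freeAmalgamMap_of_mem hAB x.2 hx, freeAmalgamMap_of_notMem hAB y.2 hy]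
    exact and_iff_right hx
  · rw [freeAmalgamMap_of_notMem hAB x.2 hx, freeAmalgamMap_of_mem hAB y.2 hy]
    exact and_iff_right hy
  · rw [freeAmalgamMap_of_notMem hAB x.2 hx, freeAmalgamMap_of_notMem hAB y.2 hy]
    exact Iff.rfl

/-- The inclusion of the second factor in the free amalgam. -/
noncomputable def freeAmalgamRight (G : SimpleGraph U) {A B : Set U} (C : Set U) (hAB : A ⊆ B) :
    G.induce C ↪g freeAmalgam G A B C where
  toFun := freeAmalgamMap C hAB
  inj' x y h := Subtype.ext (by
    rw [← elim_freeAmalgamMap hAB x, h, elim_freeAmalgamMap])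
  map_rel_iff' := freeAmalgamMap_adj hAB _ _

theorem freeAmalgamRight_of_mem {A B C : Set U} (hAB : A ⊆ B) {x : U} (hC : x ∈ C) (hx : x ∈ A) :
    freeAmalgamRight G C hAB ⟨x, hC⟩ = .inl ⟨x, hAB hx⟩ := freeAmalgamMap_of_mem hAB hC hx

theorem freeAmalgamRight_of_notMem {A B C : Set U} (hAB : A ⊆ B) {x : U} (hC : x ∈ C)
    (hx : x ∉ A) : freeAmalgamRight G C hAB ⟨x, hC⟩ = .inr ⟨x, hC, hx⟩ :=
  freeAmalgamMap_of_notMem hAB hC hx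

theorem isZero_univ_induce {S : Set U} (hS : IsZero m G S) : IsZero m (G.induce S) Set.univ :=
  isZero_induce_iff.2 (by rwa [Set.image_univ, Subtype.range_coe])

theorem sparse_freeAmalgam (hG : Sparse m G Set.univ) {A B C : Set U} (hA : IsZero m G A)
    (hB : IsZero m G B) (hC : IsZero m G C) (hAB : A ⊆ B) (hAC : A ⊆ C) :
    Sparse m (freeAmalgam G A B C) Set.univ ∧ IsZero m (freeAmalgam G A B C) Set.univ := by
  set l := freeAmalgamLeft G A B C
  set r := freeAmalgamRight G C hAB with hr
  have h1 := (hG.induce B).image l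
  have h2 := (hG.induce C).image r
  have h3 := (isZero_univ_induce hB).image l
  have h4 := (isZero_univ_induce hC).image r
  have hA' : IsZero m (G.induce B) (Subtype.val ⁻¹' A) := isZero_induce_iff.2 (by
    rwa [Subtype.image_preimage_coe, Set.inter_eq_right.2 hAB])
  have hinter : l '' Set.univ ∩ r '' Set.univ = l '' (Subtype.val ⁻¹' A) := by
    ext x
    constructor
    · rintro ⟨⟨b, -, rfl⟩, ⟨c, -, hc⟩⟩
      by_cases h : c.1 ∈ A
      · rw [hr, freeAmalgamRight_of_mem hAB c.2 h] at hc
        obtain rfl : ⟨c.1, hAB h⟩ = b := Sum.inl_injective hc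
        exact ⟨_, h, rfl⟩
      · rw [hr, freeAmalgamRight_of_notMem hAB c.2 h] at hc
        cases hc
    · rintro ⟨b, hb, rfl⟩
      exact ⟨⟨b, trivial, rfl⟩, ⟨⟨b.1, hAC hb⟩, trivial, freeAmalgamRight_of_mem hAB (hAC hb) hb⟩⟩
  have huniv : l '' Set.univ ∪ r '' Set.univ = Set.univ := by
    refine Set.eq_univ_of_forall ?_
    rintro (b | c)
    · exact Or.inl ⟨b, trivial, rfl⟩
    · exact Or.inr ⟨⟨c.1, c.2.1⟩, trivial, freeAmalgamRight_of_notMem hAB c.2.1 c.2.2⟩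
  have hsp : Sparse m (freeAmalgam G A B C) (l '' Set.univ ∪ r '' Set.univ) := by
    refine h1.union h2 (hinter ▸ hA'.image l) ?_
    rintro _ ⟨b, -, rfl⟩ _ ⟨c, -, rfl⟩ h
    by_cases hc : c.1 ∈ A
    · exact Or.inl ⟨⟨c.1, hAB hc⟩, trivial, (freeAmalgamRight_of_mem hAB c.2 hc).symm⟩
    · rw [hr, freeAmalgamRight_of_notMem hAB c.2 hc] at h
      have hb : b.1 ∈ A := h.1
      exact Or.inr ⟨⟨b.1, hAC hb⟩, trivial, freeAmalgamRight_of_mem hAB (hAC hb) hb⟩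
  have hz := h3.union h4 hsp Set.subset_union_left Set.subset_union_right
  rw [huniv] at hsp hz
  exact ⟨hsp, hz⟩

/-- Sets of predimension zero can be moved into free position over a common subset. -/
theorem ZeroGeneric.exists_free_conjugate (hG : ZeroGeneric m G) {A B C : Set U}
    (hA : IsZero m G A) (hB : IsZero m G B) (hC : IsZero m G C) (hAB : A ⊆ B) (hAC : A ⊆ C) :
    ∃ α : G ≃g G, (∀ x ∈ A, α x = x) ∧ ∀ x ∈ α '' B, ∀ y ∈ C, x ∉ A → y ∉ A →
      x ≠ y ∧ ¬ G.Adj x y := by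
  obtain ⟨hsp, hz⟩ := sparse_freeAmalgam hG.sparse hA hB hC hAB hAC
  set r := freeAmalgamRight G C hAB with hr
  -- The amalgam is embedded with `C` in its original place; `α` then carries `B` onto the copy of
  -- the left factor.
  obtain ⟨f, hf⟩ := hG.exists_embedding_over _ hsp hz hC r
  obtain ⟨α, hα⟩ := hG.homogeneous B hB (fun x => f (.inl x)) (f.injective.comp Sum.inl_injective)
    fun x y => f.map_adj_iff
  have hfix : ∀ x ∈ A, α x = x := by
    intro x hx
    have := hf ⟨x, hAC hx⟩
    rw [hr, freeAmalgamRight_of_mem hAB (hAC hx) hx] at this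
    exact (hα ⟨x, hAB hx⟩).trans this
  refine ⟨α, hfix, ?_⟩
  rintro _ ⟨x, hx, rfl⟩ y hy hxA hyA
  have hxA' : x ∉ A := fun h => hxA ((hfix x h).symm ▸ h)
  have h1 : α x = f (.inl ⟨x, hx⟩) := hα ⟨x, hx⟩
  have h2 : f (.inr ⟨y, hy, hyA⟩) = y := by
    have := hf ⟨y, hy⟩
    rwa [hr, freeAmalgamRight_of_notMem hAB hy hyA] at this
  constructor
  · intro h
    rw [h1, ← h2] at h
    cases f.injective h
  · intro h
    rw [h1, ← h2, f.map_adj_iff] at h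
    exact hxA' h.1

end FreeAmalgam

/-! ### Translation between graphs and first-order structures -/

section Structure

variable {V : Type*} {m : ℕ} {G : SimpleGraph V}

/-- An automorphism of the graph `hatGraph m G`, as an automorphism of a first-order structure. -/
def hatEquiv (σ : hatGraph m G ≃g hatGraph m G) : Hat m G ≃[Language.graph] Hat m G :=
  { σ.toEquiv with
    map_fun' := fun {_} f => isEmptyElim f
    map_rel' := fun {n} r x => by
      cases r
      exact σ.map_adj_iff }

theorem equiv_adj (g : Hat m G ≃[Language.graph] Hat m G) (x y : Hat m G) :
    (hatGraph m G).Adj (g x) (g y) ↔ (hatGraph m G).Adj x y :=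
  g.map_rel Language.adj ![x, y]

/-- An automorphism of the structure `Hat m G`, as an automorphism of a graph. -/
def graphIso (g : Hat m G ≃[Language.graph] Hat m G) : hatGraph m G ≃g hatGraph m G :=
  ⟨g.toEquiv, fun {x y} => equiv_adj g x y⟩

theorem autMap_adj {B : Language.graph.Substructure (Hat m G)} (g : B ≃[Language.graph] B)
    (x y : (B : Set (Hat m G))) :
    (hatGraph m G).Adj (ModelBase.autMap g x) (ModelBase.autMap g y) ↔
      (hatGraph m G).Adj x.1 y.1 :=
  g.map_rel Language.adj ![⟨x.1, x.2⟩, ⟨y.1, y.2⟩]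

theorem autMap_injective {B : Language.graph.Substructure (Hat m G)} (g : B ≃[Language.graph] B) :
    Function.Injective (ModelBase.autMap g) := fun _ _ h =>
  Subtype.ext (Subtype.mk.inj (g.injective (Subtype.ext h)))

theorem autMap_mem {B : Language.graph.Substructure (Hat m G)} (g : B ≃[Language.graph] B)
    (x : (B : Set (Hat m G))) : ModelBase.autMap g x ∈ B :=
  (g ⟨x.1, x.2⟩).2

/-- A set of vertices, as a substructure. -/
def toSubstructure (S : Set (Hat m G)) : Language.graph.Substructure (Hat m G) where
  carrier := S
  fun_mem f := isEmptyElim f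

theorem mem_zeroSets_iff {A : Language.graph.Substructure (Hat m G)} :
    A ∈ zeroSets m G ↔ IsZero m (hatGraph m G) (A : Set (Hat m G)) := Iff.rfl

/-- An automorphism of the induced subgraph on a set, as an automorphism of a substructure. -/
def substructureEquiv {S : Set (Hat m G)} (σ : (hatGraph m G).induce S ≃g (hatGraph m G).induce S) :
    toSubstructure S ≃[Language.graph] toSubstructure S :=
  { toEquiv := σ.toEquiv
    map_fun' := fun {_} f => isEmptyElim f
    map_rel' := fun {n} r x => by
      cases r
      exact σ.map_adj_iff }

theorem isElementaryMap_of_equiv {L : Language} {M : Type*} [L.Structure M] {D : Set M}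
    {u : D → M} (σ : M ≃[L] M) (h : ∀ x, σ x.1 = u x) : ModelBase.IsElementaryMap L u := by
  intro φ
  have : u = σ ∘ fun x : D => (x : M) := funext fun x => (h x).symm
  rw [this]
  exact (Language.StrongHomClass.realize_formula σ φ).symm

theorem isOpen_pointwiseStabilizer {L : Language} {M : Type*} [L.Structure M]
    (A : L.Substructure M) (hA : (A : Set M).Finite) :
    @IsOpen (M ≃[L] M) (ModelBase.autTopology L M) (ModelBase.pointwiseStabilizer A) := by
  let : TopologicalSpace M := ⊥
  have : DiscreteTopology M := ⟨rfl⟩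
  refine isOpen_induced_iff.2 ⟨⋂ x ∈ (A : Set M), (fun f : M → M => f x) ⁻¹' {x}, ?_, ?_⟩
  · exact hA.isOpen_biInter fun x _ =>
      (isOpen_discrete ({x} : Set M)).preimage (continuous_apply x)
  · ext g
    simp [ModelBase.pointwiseStabilizer]

/-- An elementary map on a subset of a finite set extends to an isomorphic copy of this set. -/
theorem exists_extension_of_isElementaryMap {D Z : Set (Hat m G)} {e : D → Hat m G}
    (he : ModelBase.IsElementaryMap Language.graph e) (hDZ : D ⊆ Z) (hZ : Z.Finite) :
    ∃ u : Z → Hat m G, Function.Injective u ∧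
      (∀ x y : Z, (hatGraph m G).Adj (u x) (u y) ↔ (hatGraph m G).Adj x y) ∧
      ∀ x : D, u ⟨x.1, hDZ x.2⟩ = e x := by
  classical
  have := hZ.to_subtype
  have := (hZ.subset hDZ).to_subtype
  let v (z : Z) : Language.graph.Term (D ⊕ Z) := Language.Term.var (Sum.inr z)
  -- `φ₁`, `φ₂` describe the isomorphism type of the finite graph `Z`, and `φ₃` identifies its
  -- points in `D` with the parameters. Quantifying out `Z` gives a formula over `D`, which `e`
  -- preserves.
  let φ₁ : Language.graph.Formula (D ⊕ Z) := Language.Formula.iInf fun p : Z × Z =>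
    if p.1 = p.2 then ⊤ else ∼((v p.1).equal (v p.2))
  let φ₂ : Language.graph.Formula (D ⊕ Z) := Language.Formula.iInf fun p : Z × Z =>
    if (hatGraph m G).Adj p.1 p.2 then Language.adj.formula₂ (v p.1) (v p.2)
    else ∼(Language.adj.formula₂ (v p.1) (v p.2))
  let φ₃ : Language.graph.Formula (D ⊕ Z) := Language.Formula.iInf fun x : D =>
    (Language.Term.var (Sum.inl x)).equal (v ⟨x.1, hDZ x.2⟩)
  have key (a : D → Hat m G) : ((φ₁ ⊓ φ₂ ⊓ φ₃).iExs Z).Realize a ↔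
      ∃ u : Z → Hat m G, Function.Injective u ∧
      (∀ x y : Z, (hatGraph m G).Adj (u x) (u y) ↔ (hatGraph m G).Adj x y) ∧
      ∀ x : D, u ⟨x.1, hDZ x.2⟩ = a x := by
    rw [Language.Formula.realize_iExs]
    refine exists_congr fun u => ?_
    rw [Language.Formula.realize_inf, Language.Formula.realize_inf, and_assoc,
      Language.Formula.realize_iInf, Language.Formula.realize_iInf,
      Language.Formula.realize_iInf]
    refine and_congr ?_ (and_congr ?_ ?_)
    · rw [Prod.forall]
      refine forall₂_congr fun x y => ?_
      by_cases h : x = y <;> simp [h, v]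
    · rw [Prod.forall]
      refine forall₂_congr fun x y => ?_
      have hrel (a b : Hat m G) :
        Language.Structure.RelMap Language.adj ![a, b] ↔ (hatGraph m G).Adj a b := Iff.rfl
      by_cases h : (hatGraph m G).Adj x y <;> simp [h, v, Language.Formula.realize_rel₂, hrel]
    · refine forall_congr' fun x => ?_
      simp [v, eq_comm]
  exact (key e).1 ((he _).1 ((key _).2 ⟨Subtype.val, Subtype.val_injective, fun _ _ => Iff.rfl,
    fun _ => rfl⟩))

end Structure

/-! ### The conditions for an amalgamation base -/

section AmalgamationBase

variable {V : Type*} {m : ℕ} {G : SimpleGraph V}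

theorem isBase_zeroSets (hG : ZeroGeneric m (hatGraph m G)) :
    ModelBase.IsBase (zeroSets m G) where
  countable := by
    have := hG.countable
    exact (Set.Countable.ofPred_finite.preimage SetLike.coe_injective).mono fun A hA => hA.1
  isOpen A hA := isOpen_pointwiseStabilizer A hA.1
  map_mem A hA g := by
    rw [mem_zeroSets_iff] at hA ⊢
    exact hA.image (graphIso g).toEmbedding

theorem exists_extension_zeroSets (hG : ZeroGeneric m (hatGraph m G)) (n : ℕ)
    (D : Fin n → Set (Hat m G)) (e : ∀ i, D i → Hat m G) (hD : ∀ i, (D i).Finite)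
    (he : ∀ i, ModelBase.IsElementaryMap Language.graph (e i)) {A : Set (Hat m G)}
    (hA : IsZero m (hatGraph m G) A) :
    ∃ B ∈ zeroSets m G, A ⊆ B ∧
      ∃ f : Fin n → (B ≃[Language.graph] B), ∀ i,
        ModelBase.Extends (ModelBase.autMap (f i)) (e i) := by
  choose Z hDZ hZ using fun i => hG.exists_isZero_superset (hD i)
  choose u hinj hadj hext using fun i =>
    exists_extension_of_isElementaryMap (he i) (hDZ i) (hZ i).1
  have hfin (i : Fin n) : (Set.range (u i)).Finite := by
    have := (hZ i).1.to_subtype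
    exact Set.finite_range _
  -- One zero set contains `A` and the domains and ranges of all the extended maps, so all of them
  -- extend simultaneously in the germ graph of `S`.
  obtain ⟨S, hS, hS0⟩ := hG.exists_isZero_superset
    (hA.1.union (Set.finite_iUnion fun i => (hZ i).1.union (hfin i)))
  have hAS : A ⊆ S := Set.subset_union_left.trans hS
  have hZS (i) : Z i ⊆ S := fun x hx => hS (Or.inr (Set.mem_iUnion.2 ⟨i, Or.inl hx⟩))
  have huS (i) (x : Z i) : u i x ∈ S := hS (Or.inr (Set.mem_iUnion.2 ⟨i, Or.inr ⟨x, rfl⟩⟩))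
  have := hS0.1.to_subtype
  obtain ⟨j, hj⟩ := exists_extending_partial_isomorphisms ((hatGraph m G).induce S)
    (hG.sparse.induce S) (isZero_univ_induce hS0)
  -- The germ graph is realised over `S` itself, so that `B`, the range of `k`, contains `A` and the
  -- automorphisms extend the original maps.
  obtain ⟨k, hk⟩ := hG.exists_embedding_over _ sparse_germGraph.1 sparse_germGraph.2 hS0 j
  have hp (i : Fin n) : ∃ p : germGraph m S ≃g germGraph m S,
      ∀ x (hx : x ∈ Z i), p (j ⟨x, hZS i hx⟩) = j ⟨u i ⟨x, hx⟩, huS i _⟩ := by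
    obtain ⟨p, hp⟩ := hj (Subtype.val ⁻¹' Z i) (fun x => ⟨u i ⟨x.1.1, x.2⟩, huS i _⟩)
      (isZero_induce_iff.2 (by
        rw [Subtype.image_preimage_coe, Set.inter_eq_right.2 (hZS i)]
        exact hZ i))
      (fun x y h => Subtype.ext (Subtype.ext
        (Subtype.mk.inj (hinj i (Subtype.mk.inj h)))))
      (fun x y => hadj i _ _)
    exact ⟨p, fun x hx => hp ⟨⟨x, hZS i hx⟩, hx⟩⟩
  choose p hp using hp
  let c : germGraph m S ≃g (hatGraph m G).induce (Set.range k) :=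
    ⟨Equiv.ofInjective k k.injective, k.map_rel_iff⟩
  have hSk : S ⊆ Set.range k := fun x hx => ⟨j ⟨x, hx⟩, hk ⟨x, hx⟩⟩
  refine ⟨toSubstructure (Set.range k), ?_, hAS.trans hSk,
    fun i => substructureEquiv ((c.symm.trans (p i)).trans c), fun i => ?_⟩
  · exact mem_zeroSets_iff.2 (Set.image_univ (f := k) ▸ sparse_germGraph.2.image k)
  · refine ⟨(hDZ i).trans ((hZS i).trans hSk), fun x => ?_⟩
    have hx := hDZ i x.2
    have h1 : c (j ⟨x.1, hZS i hx⟩) = ⟨x.1, hSk (hZS i hx)⟩ := Subtype.ext (hk ⟨x.1, _⟩)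
    have h2 : c.symm ⟨x.1, hSk (hZS i hx)⟩ = j ⟨x.1, hZS i hx⟩ := by
      rw [← h1, RelIso.symm_apply_apply]
    have h3 : ((c (p i (c.symm ⟨x.1, hSk (hZS i hx)⟩)) : Set.range k) : Hat m G) = e i x := by
      rw [h2, hp i x hx]
      exact (hk ⟨_, huS i _⟩).trans (hext i x)
    exact h3

theorem exists_amalgam_zeroSets (hG : ZeroGeneric m (hatGraph m G))
    {A B C : Language.graph.Substructure (Hat m G)} (hA : A ∈ zeroSets m G)
    (hB : B ∈ zeroSets m G) (hC : C ∈ zeroSets m G) (hAB : A ≤ B) (hAC : A ≤ C) :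
    ∃ α ∈ ModelBase.pointwiseStabilizer A,
      ∀ (g : B.map α.toHom ≃[Language.graph] B.map α.toHom) (h : C ≃[Language.graph] C),
        (∃ k : A ≃[Language.graph] A, ModelBase.Extends (ModelBase.autMap g) (ModelBase.autMap k) ∧
          ModelBase.Extends (ModelBase.autMap h) (ModelBase.autMap k)) →
        ∃ u : ↥(((B.map α.toHom : Language.graph.Substructure (Hat m G)) : Set (Hat m G)) ∪
            (C : Set (Hat m G))) → Hat m G,
          ModelBase.Extends u (ModelBase.autMap g) ∧ ModelBase.Extends u (ModelBase.autMap h) ∧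
            ModelBase.IsElementaryMap Language.graph u ∧
            ∃ σ : Hat m G ≃[Language.graph] Hat m G, ∀ x, σ x.1 = u x := by
  classical
  obtain ⟨α, hfix, hfree⟩ := hG.exists_free_conjugate hA hB hC hAB hAC
  refine ⟨hatEquiv α, hfix, ?_⟩
  have hB' : IsZero m (hatGraph m G) (α '' B) :=
    (mem_zeroSets_iff.1 hB).image α.toEmbedding
  have hcoe : ((B.map (hatEquiv α).toHom : Language.graph.Substructure (Hat m G)) :
    Set (Hat m G)) = α '' B := rfl
  generalize hQ : B.map (hatEquiv α).toHom = Q at *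
  rw [← hcoe] at hfree hB'
  rintro g h ⟨k, ⟨hAQ, hgk⟩, ⟨hAC', hhk⟩⟩
  -- an automorphism that restricts to `A` preserves the complement of `A`
  have hgA (x : (Q : Set (Hat m G))) (hx : x.1 ∉ A) : ModelBase.autMap g x ∉ A := by
    intro hmem
    have h1 := hgk ⟨(k.symm ⟨_, hmem⟩).1, (k.symm ⟨_, hmem⟩).2⟩
    have h2 : ModelBase.autMap k ⟨(k.symm ⟨_, hmem⟩).1, (k.symm ⟨_, hmem⟩).2⟩ =
      ModelBase.autMap g x := congrArg Subtype.val (k.apply_symm_apply ⟨_, hmem⟩)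
    have h3 := autMap_injective g (h1.trans h2)
    exact hx (h3 ▸ (k.symm ⟨_, hmem⟩).2)
  have hhA (x : (C : Set (Hat m G))) (hx : x.1 ∉ A) : ModelBase.autMap h x ∉ A := by
    intro hmem
    have h1 := hhk ⟨(k.symm ⟨_, hmem⟩).1, (k.symm ⟨_, hmem⟩).2⟩
    have h2 : ModelBase.autMap k ⟨(k.symm ⟨_, hmem⟩).1, (k.symm ⟨_, hmem⟩).2⟩ =
      ModelBase.autMap h x := congrArg Subtype.val (k.apply_symm_apply ⟨_, hmem⟩)
    have h3 := autMap_injective h (h1.trans h2)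
    exact hx (h3 ▸ (k.symm ⟨_, hmem⟩).2)
  have hagree (x : Hat m G) (hxQ : x ∈ Q) (hxC : x ∈ C) :
      ModelBase.autMap g ⟨x, hxQ⟩ = ModelBase.autMap h ⟨x, hxC⟩ := by
    by_cases hx : x ∈ A
    · exact (hgk ⟨x, hx⟩).trans (hhk ⟨x, hx⟩).symm
    · exact ((hfree x hxQ x hxC hx hx).1 rfl).elim
  let u : ↥((Q : Set (Hat m G)) ∪ (C : Set (Hat m G))) → Hat m G := fun x =>
    if hx : x.1 ∈ Q then ModelBase.autMap g ⟨x.1, hx⟩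
    else ModelBase.autMap h ⟨x.1, x.2.resolve_left hx⟩
  have hug (x) (hx : x.1 ∈ Q) : u x = ModelBase.autMap g ⟨x.1, hx⟩ := dif_pos hx
  have huh (x) (hx : x.1 ∈ C) : u x = ModelBase.autMap h ⟨x.1, hx⟩ := by
    by_cases hxQ : x.1 ∈ Q
    · exact (hug x hxQ).trans (hagree _ _ _)
    · exact dif_neg hxQ
  -- Since `A` lies in both `Q` and `C`, any pair not contained in one of them has both points
  -- outside `A`, where freeness applies.
  have hcases (x y : ↥((Q : Set (Hat m G)) ∪ (C : Set (Hat m G)))) :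
      (x.1 ∈ Q ∧ y.1 ∈ Q) ∨ (x.1 ∈ C ∧ y.1 ∈ C) ∨
        (x.1 ∈ Q ∧ y.1 ∈ C ∧ x.1 ∉ A ∧ y.1 ∉ A) ∨ (x.1 ∈ C ∧ y.1 ∈ Q ∧ x.1 ∉ A ∧ y.1 ∉ A) := by
    have h1 : x.1 ∈ Q ∨ x.1 ∈ C := x.2
    have h2 : y.1 ∈ Q ∨ y.1 ∈ C := y.2
    have h3 : ∀ {z}, z ∈ A → z ∈ Q := fun hz => hAQ hz
    have h4 : ∀ {z}, z ∈ A → z ∈ C := fun hz => hAC hz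
    have := @h3 x.1
    have := @h3 y.1
    have := @h4 x.1
    have := @h4 y.1
    tauto
  have hfreeu (x y : ↥((Q : Set (Hat m G)) ∪ (C : Set (Hat m G)))) (hx : x.1 ∈ Q) (hy : y.1 ∈ C)
      (hxA : x.1 ∉ A) (hyA : y.1 ∉ A) : u x ≠ u y ∧ ¬ (hatGraph m G).Adj (u x) (u y) := by
    rw [hug x hx, huh y hy]
    exact hfree _ (autMap_mem g _) _ (autMap_mem h _) (hgA _ hxA) (hhA _ hyA)
  have hinj : Function.Injective u := by
    intro x y hxy
    rcases hcases x y with ⟨h1, h2⟩ | ⟨h1, h2⟩ | ⟨h1, h2, h3, h4⟩ | ⟨h1, h2, h3, h4⟩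
    · rw [hug x h1, hug y h2] at hxy
      exact Subtype.ext (Subtype.mk.inj (autMap_injective g hxy))
    · rw [huh x h1, huh y h2] at hxy
      exact Subtype.ext (Subtype.mk.inj (autMap_injective h hxy))
    · exact ((hfreeu x y h1 h2 h3 h4).1 hxy).elim
    · exact ((hfreeu y x h2 h1 h4 h3).1 hxy.symm).elim
  have hadj (x y : ↥((Q : Set (Hat m G)) ∪ (C : Set (Hat m G)))) :
      (hatGraph m G).Adj (u x) (u y) ↔ (hatGraph m G).Adj x.1 y.1 := by
    rcases hcases x y with ⟨h1, h2⟩ | ⟨h1, h2⟩ | ⟨h1, h2, h3, h4⟩ | ⟨h1, h2, h3, h4⟩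
    · rw [hug x h1, hug y h2]
      exact autMap_adj g _ _
    · rw [huh x h1, huh y h2]
      exact autMap_adj h _ _
    · exact iff_of_false (hfreeu x y h1 h2 h3 h4).2 (hfree _ h1 _ h2 h3 h4).2
    · rw [SimpleGraph.adj_comm, (hatGraph m G).adj_comm x.1]
      exact iff_of_false (hfreeu y x h2 h1 h4 h3).2 (hfree _ h2 _ h1 h4 h3).2
  -- The domain of `u` is a union of two zero sets, hence zero.
  obtain ⟨σ, hσ⟩ := hG.homogeneous _ (hB'.union hC hG.sparse (Set.subset_univ _)
    (Set.subset_univ _)) u hinj hadj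
  exact ⟨u, ⟨Set.subset_union_left, fun x => hug _ x.2⟩,
    ⟨Set.subset_union_right, fun x => huh _ x.2⟩,
    isElementaryMap_of_equiv (hatEquiv σ) hσ, hatEquiv σ, hσ⟩

end AmalgamationBase

end AbInitio

theorem mainTheorem6 {V : Type*} (m : ℕ) (hm : 2 ≤ m) (G : SimpleGraph V)
    (hG : AbInitio.IsGeneric m G) :
    ModelBase.IsAmalgamationBase (AbInitio.zeroSets m G) := by
  have hgen := AbInitio.zeroGeneric_hatGraph hG
  exact
    { AbInitio.isBase_zeroSets hgen with
      exists_extension := fun n D e hD he A hA =>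
        AbInitio.exists_extension_zeroSets hgen n D e hD he hA
      exists_amalgam := fun A hA B hB C hC hAB hAC =>
        AbInitio.exists_amalgam_zeroSets hgen hA hB hC hAB hAC }
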